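/- Let $2\le N\le 2^{50}$ be an integer and let $f_1,f_2$ be integers such that $f(x)=f_1x+f_2x^2$ permutes $\mathbb Z/N\mathbb Z$; if $2\mid N$ and $4\nmid N$, assume moreover that $f_1$ is odd. Polynomials are taken with coefficients in $\mathbb Z/N\mathbb Z$ and without constant term; the degree of $g(x)=\sum_{k\ge1}g_kx^k$ is the largest $k$ with $g_k\not\equiv0\pmod N$. An inverse permutation polynomial of $f$ is such a polynomial $g$ that permutes $\mathbb Z/N\mathbb Z$ and satisfies $g(f(x))\equiv x\pmod N$ for all $x$. Write $C_k=\frac1{k+1}\binom{2k}{k}$ for the Catalan numbers. Define the following $(N-1)\times(N-1)$ matrices over $\mathbb Z/N\mathbb Z$, with indices $1\le i,j\le N-1$. The matrix $L$ is lower triangular with $l_{i,j}=\binom ij\prod_{k=i}^{i+j-1}(f_1+kf_2)$ for $i\ge j$. The matrix $D$ is diagonal with $d_{i,i}=i!$. The matrix $U$ is upper triangular with $u_{i,i}=1$ and, for $i<j$, $u_{i,j}=q^{(i,j)}V^{(i,j)}r^{(j)}$, where $q^{(i,j)}$ is the row vector with entries $(if_1+i^2f_2)^{k-1}$, $1\le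 k\le j$; $V^{(i,j)}=W^{(i-1,j)}W^{(i-2,j)}\cdots W^{(1,j)}$ (the identity if $i=1$); $W^{(k,j)}$ is the $j\times j$ matrix with entries $(kf_1+k^2f_2)^{n-m-1}$ at $(m,n)$ for $m<n$ and $0$ otherwise; and $r^{(j)}=[0,\dots,0,1]^T$ has length $j$. Then every $f_1+mf_2$ with $m\ge1$ is a unit modulo $N$ and $L$ is invertible; put $e=L^{-1}[1,2,\dots,N-1]^T$. Then $f$ has an inverse permutation polynomial, and an integer $K$ is the least degree of an inverse permutation polynomial of $f$ if and only if $K$ is the smallest integer $K\ge1$ with $$(K+1)!\,C_K\,f_2^K\equiv0\pmod N.$$ For this $K$ one has $K\le N-1$, and there are exactly $\prod_{k=1}^K\gcd(k!,N)$ inverse permutation polynomials of degree $K$. Write now $D,U,e$ for the leading $K\times K$ submatrices of $D,U$ and the leading $K\times1$ part of $e$, and identify $g=[g_1,\dots,g_K]^T$ with $\sum_{k=1}^Kg_kx^k$. (1) The inverse permutation polynomials of degree $K$ are exactly the $g$ for which there is an $h$ with $Dh\equiv e$ and $h\equiv Ug\pmod N$. (2) Let $h_k\equiv\dfrac{C_{k-1}(-f_2)^{k-1}}{\prod_{m=1}^{2k-1}(f_1+mf_2)}\pmod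 N$ for $1\le k\le K$. There is a unique $g$ with $h\equiv Ug$, and the inverse permutation polynomials of degree $K$ are exactly the sums $g+z$, where $z$ runs over the zero polynomials modulo $N$ of degree at most $K$, that is, the polynomials without constant term of degree at most $K$ (including $0$) that vanish at every residue modulo $N$. There are $\prod_{k=1}^K\gcd(k!,N)$ such $z$, and they are exactly the polynomials $$\sum_{k=1}^K\frac{N}{\gcd(k!,N)}\,\tau_k\prod_{m=0}^{k-1}(x-m),\qquad 0\le\tau_k\le\gcd(k!,N)-1.$$ -/

import Mathlib

namespace QPP

open Polynomial

/-- The quadratic polynomial `f₁ x + f₂ x²` modulo `N`. -/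
noncomputable def quad (N : ℕ) (f₁ f₂ : ℤ) : (ZMod N)[X] :=
  C (f₁ : ZMod N) * X + C (f₂ : ZMod N) * X ^ 2

/-- A permutation polynomial modulo `N`: constant-free, and permuting the residues modulo `N`.
Coefficients are taken modulo `N`, so congruent polynomials are identified (but distinct
equivalent ones are not), and `natDegree` is the largest `k` with `g_k ≢ 0 (mod N)`. -/
def IsPP {N : ℕ} (g : (ZMod N)[X]) : Prop :=
  g.coeff 0 = 0 ∧ Function.Bijective (fun x : ZMod N => g.eval x)

/-- `g` is an inverse permutation polynomial of `f`. -/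
def IsInversePP {N : ℕ} (f g : (ZMod N)[X]) : Prop :=
  IsPP g ∧ ∀ x : ZMod N, g.eval (f.eval x) = x

/-- `K` is the least degree of an inverse permutation polynomial of `f`. -/
def IsLeastInverseDegree {N : ℕ} (f : (ZMod N)[X]) (K : ℕ) : Prop :=
  IsLeast {d : ℕ | ∃ g : (ZMod N)[X], IsInversePP f g ∧ g.natDegree = d} K

/-- The inverse permutation polynomials of `f` of degree `K`. -/
def inversesOfDegree {N : ℕ} (f : (ZMod N)[X]) (K : ℕ) : Set (ZMod N)[X] :=
  {g | IsInversePP f g ∧ g.natDegree = K}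

/-- The constant-free zero polynomials modulo `N` of degree at most `K`
(the trivial one included). -/
def zeroPolys (N K : ℕ) : Set (ZMod N)[X] :=
  {z | z.coeff 0 = 0 ∧ z.natDegree ≤ K ∧ ∀ x : ZMod N, z.eval x = 0}

/-- The polynomial `∑_{k=1}^K v_k x^k`; the entry `v_k` has index `k - 1` in `Fin K`. -/
noncomputable def toPoly {N K : ℕ} (v : Fin K → ZMod N) : (ZMod N)[X] :=
  ∑ i : Fin K, C (v i) * X ^ ((i : ℕ) + 1)

section Matrices

variable {R : Type*} [CommRing R] (a b : R)

/-! Rows and columns numbered from `1` on paper are numbered from `0` in `Fin n`. Here `a`, `b`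
stand for `f₁`, `f₂`; superscripts `i`, `j`, `k` remain numbered from `1`. -/

/-- `l_{i,j} = binom(i,j) ∏_{k=i}^{i+j-1} (a + k b)` for `i ≥ j`, and `0` otherwise. -/
def matL (n : ℕ) : Matrix (Fin n) (Fin n) R := fun i j =>
  if j ≤ i then
    (Nat.choose ((i : ℕ) + 1) ((j : ℕ) + 1) : R) *
      ∏ k ∈ Finset.Ico ((i : ℕ) + 1) (((i : ℕ) + 1) + ((j : ℕ) + 1)), (a + (k : R) * b)
  else 0

/-- The diagonal matrix with entries `1!, 2!, …, n!`. -/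
def matD (n : ℕ) : Matrix (Fin n) (Fin n) R :=
  Matrix.diagonal fun i => (Nat.factorial ((i : ℕ) + 1) : R)

/-- The strictly upper triangular `j × j` matrix `W^{(k,j)}`,
with entry `(k a + k² b)^(n-m-1)` at `(m, n)` for `m < n`. -/
def matW (k j : ℕ) : Matrix (Fin j) (Fin j) R := fun m n =>
  if n ≤ m then 0 else ((k : R) * a + (k : R) ^ 2 * b) ^ ((n : ℕ) - m - 1)

/-- `V^{(i,j)} = W^{(i-1,j)} W^{(i-2,j)} ⋯ W^{(1,j)}`, the identity for `i = 1`
(the value at `i = 0` is never used). -/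
def matV (j : ℕ) : ℕ → Matrix (Fin j) (Fin j) R
  | 0 => 1
  | 1 => 1
  | i + 2 => matW a b (i + 1) j * matV j (i + 1)

/-- The row vector `q^{(i,j)}` with entries `(i a + i² b)^(k-1)`, `1 ≤ k ≤ j`. -/
def vecQ (i j : ℕ) : Fin j → R := fun k =>
  ((i : R) * a + (i : R) ^ 2 * b) ^ (k : ℕ)

/-- The column vector `r^{(j)} = [0, …, 0, 1]ᵀ`. -/
def vecR (R : Type*) [CommRing R] (j : ℕ) : Fin j → R := fun k =>
  if (k : ℕ) + 1 = j then 1 else 0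

/-- The upper unitriangular matrix `U` with `u_{i,j} = q^{(i,j)} V^{(i,j)} r^{(j)}` for `i < j`. -/
def matU (n : ℕ) : Matrix (Fin n) (Fin n) R := fun i j =>
  if i = j then 1
  else if i < j then
    vecQ a b ((i : ℕ) + 1) ((j : ℕ) + 1) ⬝ᵥ
      Matrix.mulVec (matV a b ((j : ℕ) + 1) ((i : ℕ) + 1)) (vecR R ((j : ℕ) + 1))
  else 0

/-- `b = [1, 2, …, n]ᵀ`. -/
def vecB (R : Type*) [CommRing R] (n : ℕ) : Fin n → R := fun i => ((i : ℕ) + 1 : R)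

/-- `e = L⁻¹ b`. -/
noncomputable def vecE (n : ℕ) : Fin n → R := Matrix.mulVec (matL a b n)⁻¹ (vecB R n)

end Matrices

/-- The `K × K` leading submatrix. -/
def leadMat {R : Type*} {n K : ℕ} (hK : K ≤ n) (M : Matrix (Fin n) (Fin n) R) :
    Matrix (Fin K) (Fin K) R :=
  M.submatrix (Fin.castLE hK) (Fin.castLE hK)

/-- The `K × 1` leading subvector. -/
def leadVec {R : Type*} {n K : ℕ} (hK : K ≤ n) (v : Fin n → R) : Fin K → R :=
  fun i => v (Fin.castLE hK i)

/-- The vector with `k`-th entry `C_{k-1} (-f₂)^(k-1) / ∏_{m=1}^{2k-1} (f₁ + m f₂)` modulo `N`,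
for `1 ≤ k ≤ K`, where `C_{k-1}` is a Catalan number. -/
def particularH (N : ℕ) (f₁ f₂ : ℤ) (K : ℕ) : Fin K → ZMod N := fun i =>
  (catalan (i : ℕ) : ZMod N) * (-(f₂ : ZMod N)) ^ (i : ℕ) *
    (∏ m ∈ Finset.Icc 1 (2 * ((i : ℕ) + 1) - 1), ((f₁ : ZMod N) + (m : ZMod N) * (f₂ : ZMod N)))⁻¹

/-- The polynomial `∑_{k=1}^K (N / gcd(k!, N)) τ_k ∏_{m=0}^{k-1} (x - m)` modulo `N`. -/
noncomputable def explicitZero (N K : ℕ) (τ : ℕ → ℕ) : (ZMod N)[X] :=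
  ∑ k ∈ Finset.Icc 1 K,
    C ((N / Nat.gcd (Nat.factorial k) N * τ k : ℕ) : ZMod N) *
      ∏ m ∈ Finset.range k, (X - C (m : ZMod N))

end QPP

/-!
Put `y_i = f(i)`. An inverse of degree at most `K` without constant term is a polynomial taking the
value `i` at each node `y_i`. In the Newton basis `∏_{m < k} (x - y_m)` these conditions read
`L D h = [1, 2, …]ᵀ`, and `h = U g` is the change of basis from the monomials, since the products of
the matrices `W` compute the complete homogeneous symmetric polynomials of the nodes.

The factorization `y_i - y_j = (i - j) (f₁ + (i + j) f₂)`, whose second factor is a unit, makes `L`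
invertible; it also makes the divided differences of the inverse at the nodes computable in closed
form: they are `C_{k-1} (-f₂)^(k-1)` over a product of units. So the conditions become
`k! h_k = k! C_{k-1} (-f₂)^(k-1) / (unit)` for all `k`. A solution with `h_k = 0` for `k > K` exists
if and only if the right-hand sides with `k > K` vanish, and because `(k + 1)! C_k` divides
`(k + 2)! C_{k+1}` only `k = K + 1` matters.

Zero polynomials are the homogeneous case for the nodes `0, 1, 2, …`, that is, `k! c_k = 0` for the
coordinates in the basis of falling factorials.
-/

namespace QPP

open Polynomial Finset Matrix

section NewtonBasis

variable {R : Type*} [CommRing R] (y : ℕ → R)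

/-- The Newton basis polynomial `∏_{m < k} (X - y_m)` at the nodes `y_0, y_1, …`. -/
noncomputable def newtonBasis (k : ℕ) : R[X] := ∏ m ∈ range k, (X - C (y m))

theorem newtonBasis_succ (k : ℕ) : newtonBasis y (k + 1) = newtonBasis y k * (X - C (y k)) :=
  prod_range_succ _ k

theorem eval_newtonBasis (k : ℕ) (x : R) :
    (newtonBasis y k).eval x = ∏ m ∈ range k, (x - y m) := by
  simp [newtonBasis, eval_prod]

/-- The coefficient of `newtonBasis y i` in `X ^ j`. It is the complete homogeneous symmetric
polynomial of degree `j - i` in `y_0, …, y_i`, encoded by its Pascal-type recursion so that it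
vanishes for `j < i`. -/
def newtonCoeff : ℕ → ℕ → R
  | 0, 0 => 1
  | 0, j + 1 => y 0 * newtonCoeff 0 j
  | _ + 1, 0 => 0
  | i + 1, j + 1 => newtonCoeff i j + y (i + 1) * newtonCoeff (i + 1) j

theorem newtonCoeff_zero_left (j : ℕ) : newtonCoeff y 0 j = y 0 ^ j := by
  induction j with
  | zero => rw [newtonCoeff, pow_zero]
  | succ j ih => rw [newtonCoeff, ih, pow_succ']

theorem newtonCoeff_eq_zero_of_lt {i j : ℕ} (h : j < i) : newtonCoeff y i j = 0 := by
  induction j generalizing i with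
  | zero =>
    obtain ⟨i, rfl⟩ := Nat.exists_eq_add_one_of_ne_zero h.ne'
    rw [newtonCoeff]
  | succ j ih =>
    obtain ⟨i, rfl⟩ := Nat.exists_eq_add_one_of_ne_zero h.ne_bot
    rw [newtonCoeff, ih (by omega), ih (by omega), mul_zero, add_zero]

theorem newtonCoeff_self (i : ℕ) : newtonCoeff y i i = 1 := by
  induction i with
  | zero => rw [newtonCoeff]
  | succ i ih =>
    rw [newtonCoeff, ih, newtonCoeff_eq_zero_of_lt y i.lt_succ_self, mul_zero, add_zero]

theorem newtonCoeff_succ_eq_sum (i j : ℕ) :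
    newtonCoeff y (i + 1) j =
      ∑ t ∈ range j, y (i + 1) ^ t * newtonCoeff y i (j - 1 - t) := by
  induction j with
  | zero => rw [newtonCoeff, range_zero, sum_empty]
  | succ j ih =>
    rw [newtonCoeff, ih, sum_range_succ', mul_sum, add_comm, pow_zero, one_mul]
    congr 1
    refine sum_congr rfl fun t _ => ?_
    rw [pow_succ', mul_assoc, Nat.add_sub_cancel, Nat.sub_sub, add_comm 1 t]

theorem X_pow_eq_sum_newtonBasis {j n : ℕ} (h : j < n) :
    (X : R[X]) ^ j = ∑ i ∈ range n, C (newtonCoeff y i j) * newtonBasis y i := by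
  induction j generalizing n with
  | zero =>
    rw [sum_eq_single_of_mem 0 (mem_range.2 h)]
    · simp [newtonCoeff, newtonBasis]
    · intro i _ hi
      rw [newtonCoeff_eq_zero_of_lt y (Nat.pos_of_ne_zero hi), C_0, zero_mul]
  | succ j ih =>
    obtain ⟨n, rfl⟩ := Nat.exists_eq_add_one_of_ne_zero h.ne_bot
    have hshift : ∑ i ∈ range n, C (y i * newtonCoeff y i j) * newtonBasis y i =
        ∑ i ∈ range n, C (y (i + 1) * newtonCoeff y (i + 1) j) * newtonBasis y (i + 1) +
          C (y 0 * newtonCoeff y 0 j) * newtonBasis y 0 := by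
      rw [← sum_range_succ' (fun i => C (y i * newtonCoeff y i j) * newtonBasis y i),
        sum_range_succ, newtonCoeff_eq_zero_of_lt y (Nat.lt_of_succ_lt_succ h), mul_zero, C_0,
        zero_mul, add_zero]
    calc (X : R[X]) ^ (j + 1)
        = ∑ i ∈ range n, (C (newtonCoeff y i j) * newtonBasis y (i + 1) +
            C (y i * newtonCoeff y i j) * newtonBasis y i) := by
          rw [pow_succ, ih (Nat.lt_of_succ_lt_succ h), sum_mul]
          refine sum_congr rfl fun i _ => ?_
          rw [newtonBasis_succ, C_mul]
          ring
      _ = ∑ i ∈ range (n + 1), C (newtonCoeff y i (j + 1)) * newtonBasis y i := by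
          rw [sum_add_distrib, hshift, sum_range_succ', ← add_assoc, ← sum_add_distrib]
          simp only [newtonCoeff, C_add, add_mul]

/-- The polynomial with coordinates `h` in the Newton basis without its constant member: the
entry `h k` is the coefficient of `newtonBasis y (k + 1)`. -/
noncomputable def newtonPoly {K : ℕ} (h : Fin K → R) : R[X] :=
  ∑ k : Fin K, C (h k) * newtonBasis y (k + 1)

theorem eval_newtonPoly {K : ℕ} (h : Fin K → R) (x : R) :
    (newtonPoly y h).eval x = ∑ k, h k * (newtonBasis y (k + 1)).eval x := by
  simp only [newtonPoly, eval_finsetSum, eval_mul, eval_C]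

theorem newtonPoly_append_zero {K n : ℕ} (h : Fin K → R) :
    newtonPoly y (Fin.append h (0 : Fin n → R)) = newtonPoly y h := by
  simp [newtonPoly, Fin.sum_univ_add]

end NewtonBasis

section DividedDifferences

variable {R : Type*} [CommRing R]

/-- A table `d` of divided differences at the nodes `y`: the entry `d s k` belongs to the nodes
`y_s, …, y_{s + k}`, so `d s 0` is the value prescribed at `y_s`. The recursion is written without
division, since differences of nodes need not be invertible. -/
def IsDividedDifferenceTable (y : ℕ → R) (d : ℕ → ℕ → R) : Prop :=
  ∀ s k, d (s + 1) k = d s k + d s (k + 1) * (y (s + k + 1) - y s)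

namespace IsDividedDifferenceTable

variable {y : ℕ → R} {d : ℕ → ℕ → R}

-- Both sides interpolate at `y_s, …, y_{s + n + 1}`, with `y_s` taken first or last.
theorem sum_range_succ_eq_shift (hd : IsDividedDifferenceTable y d) (s n : ℕ) (x : R) :
    ∑ k ∈ range (n + 2), d s k * ∏ m ∈ range k, (x - y (s + m)) =
      ∑ k ∈ range (n + 1), d (s + 1) k * ∏ m ∈ range k, (x - y (s + 1 + m)) +
        d s (n + 1) * ∏ m ∈ range (n + 1), (x - y (s + 1 + m)) := by
  have hprod (k : ℕ) : ∏ m ∈ range (k + 1), (x - y (s + m)) =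
      (∏ m ∈ range k, (x - y (s + 1 + m))) * (x - y s) := by
    simp only [prod_range_succ', add_zero, add_right_comm s 1, add_assoc]
  induction n with
  | zero =>
    simp only [sum_range_succ, range_zero, sum_empty, prod_range_succ, prod_empty, hd s 0, add_zero]
    ring
  | succ n ih =>
    rw [sum_range_succ, ih, hprod, sum_range_succ _ (n + 1), hd s (n + 1),
      prod_range_succ _ (n + 1), show s + 1 + (n + 1) = s + (n + 1) + 1 by ring]
    ring

theorem sum_mul_prod_sub_eq (hd : IsDividedDifferenceTable y d) (s n : ℕ) :
    ∑ k ∈ range (n + 1), d s k * ∏ m ∈ range k, (y (s + n) - y (s + m)) = d (s + n) 0 := by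
  induction n generalizing s with
  | zero => simp
  | succ n ih =>
    rw [hd.sum_range_succ_eq_shift, show s + (n + 1) = s + 1 + n by ring, ih,
      prod_range_succ, sub_self, mul_zero, mul_zero, add_zero]

theorem sum_mul_eval_newtonBasis (hd : IsDividedDifferenceTable y d) (n : ℕ) :
    ∑ k ∈ range (n + 1), d 0 k * (newtonBasis y k).eval (y n) = d n 0 := by
  simpa only [eval_newtonBasis, zero_add] using hd.sum_mul_prod_sub_eq 0 n

end IsDividedDifferenceTable

end DividedDifferences

section QuadraticNodes

variable {R : Type*} [CommRing R] (a b : R)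

/-- The value `a i + b i²` of the quadratic polynomial at the natural number `i`; these values
are the interpolation nodes. -/
def node (i : ℕ) : R := (i : R) * a + (i : R) ^ 2 * b

@[simp] theorem node_zero : node a b 0 = 0 := by simp [node]

theorem node_sub_node (i j : ℕ) :
    node a b i - node a b j = ((i : R) - j) * (a + ((i + j : ℕ) : R) * b) := by
  simp only [node, Nat.cast_add]
  ring

/-- The slopes `a + m b = (y_i - y_j) / (i - j)`, `m = i + j`, of the secants of `a x + b x²`
through natural numbers are units. -/
def HasUnitSlopes : Prop := ∀ m : ℕ, 1 ≤ m → IsUnit (a + (m : R) * b)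

theorem matV_mulVec_vecR (j i : ℕ) (m : Fin j) :
    (matV a b j (i + 1) *ᵥ vecR R j) m = newtonCoeff (node a b) i (j - 1 - m) := by
  have hm : (m : ℕ) < j := m.isLt
  induction i generalizing m with
  | zero =>
    rw [newtonCoeff_zero_left, node_zero, zero_pow_eq, matV, one_mulVec, vecR]
    congr 1
    simp only [eq_iff_iff]
    omega
  | succ i ih =>
    rw [matV, ← mulVec_mulVec, newtonCoeff_succ_eq_sum, mulVec, dotProduct]
    simp only [ih _ (Fin.isLt _), matW, Fin.le_def]
    rw [Fin.sum_univ_eq_sum_range (fun n => (if n ≤ (m : ℕ) then (0 : R) else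
        (((i + 1 : ℕ) : R) * a + ((i + 1 : ℕ) : R) ^ 2 * b) ^ (n - m - 1)) *
          newtonCoeff (node a b) i (j - 1 - n)) j,
      ← sum_range_add_sum_Ico _ (Nat.succ_le_of_lt hm), sum_eq_zero, zero_add,
      sum_Ico_eq_sum_range, show j - ((m : ℕ) + 1) = j - 1 - m by omega]
    · refine sum_congr rfl fun t _ => ?_
      rw [if_neg (by omega), node]
      congr 2 <;> omega
    · intro n hn
      rw [if_pos (Nat.le_of_lt_succ (mem_range.1 hn)), zero_mul]

theorem matU_apply (n : ℕ) (i j : Fin n) :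
    matU a b n i j = newtonCoeff (node a b) (i + 1) (j + 1) := by
  unfold matU
  split_ifs with heq hlt
  · rw [heq, newtonCoeff_self]
  · rw [newtonCoeff_succ_eq_sum, dotProduct, sum_range]
    simp only [matV_mulVec_vecR, vecQ, node]
  · rw [newtonCoeff_eq_zero_of_lt]
    exact Nat.succ_lt_succ ((not_lt.1 hlt).lt_of_ne' heq)

theorem isUnit_matU (n : ℕ) : IsUnit (matU a b n) := by
  rw [isUnit_iff_isUnit_det, det_of_isUpperTriangular]
  · simp [matU]
  · intro i j hij
    rw [matU_apply, newtonCoeff_eq_zero_of_lt]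
    exact Nat.succ_lt_succ hij

theorem mulVec_matU_bijective (n : ℕ) : Function.Bijective (matU a b n *ᵥ ·) :=
  ⟨mulVec_injective_of_isUnit (isUnit_matU a b n),
    mulVec_surjective_iff_isUnit.2 (isUnit_matU a b n)⟩

variable {a b} in
theorem HasUnitSlopes.isUnit_matL (hu : HasUnitSlopes a b) (n : ℕ) : IsUnit (matL a b n) := by
  rw [isUnit_iff_isUnit_det, det_of_isLowerTriangular]
  · refine IsUnit.prod_univ_iff.2 fun i => ?_
    rw [matL, if_pos le_rfl, Nat.choose_self, Nat.cast_one, one_mul]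
    exact IsUnit.prod_iff.2 fun k hk => hu k ((Nat.succ_pos i).trans_le (mem_Ico.1 hk).1)
  · exact fun i j hij => if_neg (not_le.2 hij)

theorem eval_newtonBasis_node (k i : ℕ) :
    (newtonBasis (node a b) k).eval (node a b i) =
      (k.factorial : R) * ((i.choose k : R) * ∏ t ∈ Ico i (i + k), (a + (t : R) * b)) := by
  have hfalling : ∏ m ∈ range k, ((i : R) - m) = (k.factorial : R) * i.choose k := by
    rw [← descPochhammer_eval_eq_prod_range, descPochhammer_eval_eq_descFactorial,
      Nat.descFactorial_eq_factorial_mul_choose, Nat.cast_mul]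
  simp only [eval_newtonBasis, node_sub_node]
  rw [prod_mul_distrib, hfalling, mul_assoc, prod_Ico_eq_prod_range, Nat.add_sub_cancel_left]

theorem matL_mulVec_matD_mulVec {n : ℕ} (h : Fin n → R) (i : Fin n) :
    (matL a b n *ᵥ (matD n *ᵥ h)) i = (newtonPoly (node a b) h).eval (node a b (i + 1)) := by
  rw [eval_newtonPoly, mulVec, dotProduct]
  refine sum_congr rfl fun k _ => ?_
  rw [matD, mulVec_diagonal, eval_newtonBasis_node, matL]
  split_ifs with hk
  · ring
  · rw [Nat.choose_eq_zero_of_lt (Nat.succ_lt_succ (not_le.1 hk)), Nat.cast_zero]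
    ring

theorem leadMat_matU {n K : ℕ} (hK : K ≤ n) : leadMat hK (matU a b n) = matU a b K := by
  ext i j
  simp only [leadMat, submatrix_apply, matU_apply, Fin.val_castLE]

variable (R) in
theorem leadMat_matD {n K : ℕ} (hK : K ≤ n) :
    leadMat hK (matD n : Matrix (Fin n) (Fin n) R) = matD K :=
  submatrix_diagonal _ _ (Fin.castLE_injective hK)

theorem matD_mulVec_eq_zero_iff {n : ℕ} (c : Fin n → R) :
    matD n *ᵥ c = 0 ↔ ∀ k : Fin n, (((k : ℕ) + 1).factorial : R) * c k = 0 := by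
  simp only [funext_iff, matD, mulVec_diagonal, Pi.zero_apply]

end QuadraticNodes

section InverseDifferences

theorem catalan_succ_mul (k : ℕ) : catalan (k + 1) * (k + 2) = 2 * (2 * k + 1) * catalan k := by
  refine Nat.eq_of_mul_eq_mul_left k.succ_pos ?_
  have hrec := Nat.succ_mul_centralBinom_succ k
  rw [← succ_mul_catalan_eq_centralBinom, ← succ_mul_catalan_eq_centralBinom] at hrec
  linarith

theorem factorial_mul_catalan_dvd {k l : ℕ} (hkl : k ≤ l) :
    (k + 1).factorial * catalan k ∣ (l + 1).factorial * catalan l := by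
  induction l, hkl using Nat.le_induction with
  | base => rfl
  | succ l _ ih =>
    refine ih.trans ⟨2 * (2 * l + 1), ?_⟩
    rw [Nat.factorial_succ, mul_right_comm, mul_comm (l + 1 + 1), catalan_succ_mul]
    ring

variable {R : Type*} [CommRing R] (a b : R)

/-- The product `∏_{m = 1}^{2k+1} (a + (2s + m) b)`, the denominator of the divided difference of
order `k + 1` of the inverse of `a x + b x²`. -/
def differenceDenom (s k : ℕ) : R := ∏ m ∈ range (2 * k + 1), (a + ((2 * s + m + 1 : ℕ) : R) * b)

theorem differenceDenom_succ_right (s k : ℕ) :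
    differenceDenom a b s (k + 1) = differenceDenom a b s k *
      ((a + ((2 * s + 2 * k + 2 : ℕ) : R) * b) * (a + ((2 * s + 2 * k + 3 : ℕ) : R) * b)) := by
  rw [differenceDenom, show 2 * (k + 1) + 1 = 2 * k + 1 + 1 + 1 by ring, prod_range_succ,
    prod_range_succ, mul_assoc]
  rfl

theorem differenceDenom_succ_left (s k : ℕ) :
    differenceDenom a b s (k + 1) = differenceDenom a b (s + 1) k *
      ((a + ((2 * s + 2 : ℕ) : R) * b) * (a + ((2 * s + 1 : ℕ) : R) * b)) := by
  rw [differenceDenom, show 2 * (k + 1) + 1 = 2 * k + 1 + 1 + 1 by ring, prod_range_succ',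
    prod_range_succ', mul_assoc, differenceDenom]
  congr 1
  refine prod_congr rfl fun m _ => ?_
  rw [show 2 * s + (m + 1 + 1) + 1 = 2 * (s + 1) + m + 1 by ring]

/-- The divided difference of the inverse of `x ↦ a x + b x²` at the nodes `y_s, …, y_{s + k}`. -/
noncomputable def inverseDifference (s : ℕ) : ℕ → R
  | 0 => s
  | k + 1 => catalan k * (-b) ^ k * Ring.inverse (differenceDenom a b s k)

variable {a b}

theorem HasUnitSlopes.isUnit_differenceDenom (hu : HasUnitSlopes a b) (s k : ℕ) :
    IsUnit (differenceDenom a b s k) :=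
  IsUnit.prod_iff.2 fun m _ => hu _ (2 * s + m).succ_pos

theorem inverse_eq_mul_inverse_of_eq_mul {x y z : R} (h : z = x * y) (hz : IsUnit z) :
    Ring.inverse x = y * Ring.inverse z := by
  subst h
  rw [Ring.eq_mul_inverse_iff_mul_eq _ _ _ hz,
    Ring.inverse_mul_cancel_left _ _ (isUnit_of_mul_isUnit_left hz)]

theorem HasUnitSlopes.isDividedDifferenceTable (hu : HasUnitSlopes a b) :
    IsDividedDifferenceTable (node a b) (inverseDifference a b) := by
  rintro s (_ | k)
  · have hden : differenceDenom a b s 0 = node a b (s + 1) - node a b s := by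
      rw [node_sub_node, differenceDenom, prod_range_one]
      push_cast
      ring
    rw [add_zero, ← hden]
    simp only [inverseDifference, catalan_zero, Nat.cast_one, pow_zero, mul_one, one_mul,
      Ring.inverse_mul_cancel _ (hu.isUnit_differenceDenom s 0), Nat.cast_succ s]
  · have hunit := hu.isUnit_differenceDenom s (k + 1)
    have hcat : (catalan (k + 1) : R) * (k + 2) = 2 * (2 * k + 1) * catalan k := by
      exact_mod_cast congrArg (Nat.cast (R := R)) (catalan_succ_mul k)
    simp only [inverseDifference]
    rw [inverse_eq_mul_inverse_of_eq_mul (differenceDenom_succ_right a b s k) hunit,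
      inverse_eq_mul_inverse_of_eq_mul (differenceDenom_succ_left a b s k) hunit, node_sub_node]
    push_cast
    linear_combination (-(-b) ^ (k + 1) * Ring.inverse (differenceDenom a b s (k + 1)) *
      (a + (2 * (s : R) + k + 2) * b)) * hcat

variable (a b) in
/-- The coordinates of the inverse of `x ↦ a x + b x²` in the Newton basis at the nodes
`y_0 = 0, y_1, …`, the zeroth coordinate (which vanishes) being omitted. -/
noncomputable def inverseCoords (K : ℕ) : Fin K → R := fun k => inverseDifference a b 0 (k + 1)

namespace HasUnitSlopes

theorem matL_mulVec_matD_mulVec_inverseCoords (hu : HasUnitSlopes a b) (n : ℕ) :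
    matL a b n *ᵥ (matD n *ᵥ inverseCoords a b n) = vecB R n := by
  ext i
  set y := node a b
  have hinterp := hu.isDividedDifferenceTable.sum_mul_eval_newtonBasis (i + 1)
  rw [sum_range_succ'] at hinterp
  have hvanish : ∀ k ∈ range n, k ∉ range (i + 1) →
      inverseDifference a b 0 (k + 1) * (newtonBasis y (k + 1)).eval (y (i + 1)) = 0 := by
    intro k _ hk
    rw [eval_newtonBasis_node, Nat.choose_eq_zero_of_lt (by simpa using hk), Nat.cast_zero]
    ring
  calc _ = ∑ k ∈ range n, inverseDifference a b 0 (k + 1) *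
          (newtonBasis y (k + 1)).eval (y (i + 1)) := by
        rw [matL_mulVec_matD_mulVec, eval_newtonPoly, sum_range]
        rfl
    _ = ∑ k ∈ range (i + 1), inverseDifference a b 0 (k + 1) *
          (newtonBasis y (k + 1)).eval (y (i + 1)) :=
        (sum_subset (range_mono i.isLt) hvanish).symm
    _ = vecB R n i := by
        simpa [inverseDifference, vecB] using hinterp

theorem vecE_eq (hu : HasUnitSlopes a b) (n : ℕ) :
    vecE a b n = matD n *ᵥ inverseCoords a b n := by
  rw [vecE, ← hu.matL_mulVec_matD_mulVec_inverseCoords, mulVec_mulVec,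
    nonsing_inv_mul _ ((isUnit_iff_isUnit_det _).1 (hu.isUnit_matL n)), one_mulVec]

theorem leadVec_vecE (hu : HasUnitSlopes a b) {n K : ℕ} (hK : K ≤ n) :
    leadVec hK (vecE a b n) = matD K *ᵥ inverseCoords a b K := by
  ext k
  simp only [leadVec, hu.vecE_eq, matD, mulVec_diagonal, inverseCoords, Fin.val_castLE]

theorem factorial_mul_inverseDifference_eq_zero_iff (hu : HasUnitSlopes a b) (k : ℕ) :
    ((k + 1).factorial : R) * inverseDifference a b 0 (k + 1) = 0 ↔
      ((k + 1).factorial : R) * catalan k * b ^ k = 0 := by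
  have hunit : IsUnit ((-1 : R) ^ k * Ring.inverse (differenceDenom a b 0 k)) :=
    (isUnit_one.neg.pow k).mul (hu.isUnit_differenceDenom 0 k).ringInverse
  rw [← hunit.mul_left_eq_zero (a := _ * b ^ k), inverseDifference, neg_pow]
  ring_nf

end HasUnitSlopes

theorem factorial_mul_catalan_mul_pow_eq_zero_of_le {k l : ℕ} (hkl : k ≤ l)
    (hk : ((k + 1).factorial : R) * catalan k * b ^ k = 0) :
    ((l + 1).factorial : R) * catalan l * b ^ l = 0 := by
  rw [← zero_dvd_iff, ← hk]
  refine mul_dvd_mul ?_ (pow_dvd_pow b hkl)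
  exact_mod_cast Nat.cast_dvd_cast (α := R) (factorial_mul_catalan_dvd hkl)

end InverseDifferences

@[to_additive]
theorem prod_Icc_eq_prod_fin {M : Type*} [CommMonoid M] (f : ℕ → M) (n : ℕ) :
    ∏ i ∈ Icc 1 n, f i = ∏ i : Fin n, f (i + 1) := by
  rw [← Ico_add_one_right_eq_Icc, prod_Ico_eq_prod_range, Nat.add_sub_cancel, prod_range]
  simp only [add_comm]

variable {N : ℕ}

theorem HasUnitSlopes.particularH_eq {f₁ f₂ : ℤ}
    (hu : HasUnitSlopes (f₁ : ZMod N) (f₂ : ZMod N)) (K : ℕ) :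
    particularH N f₁ f₂ K = inverseCoords (f₁ : ZMod N) (f₂ : ZMod N) K := by
  ext k
  have hden : ∏ m ∈ Icc 1 (2 * ((k : ℕ) + 1) - 1), ((f₁ : ZMod N) + (m : ZMod N) * f₂) =
      differenceDenom (f₁ : ZMod N) (f₂ : ZMod N) 0 k := by
    rw [prod_Icc_eq_prod_fin, differenceDenom, ← prod_range (fun m =>
      (f₁ : ZMod N) + ((m + 1 : ℕ) : ZMod N) * f₂)]
    simp only [Nat.mul_zero, zero_add]
    rfl
  rw [particularH, inverseCoords, inverseDifference, hden, ZMod.inv_eq_of_mul_eq_one N _ _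
    (Ring.mul_inverse_cancel _ (hu.isUnit_differenceDenom 0 k))]

section Coordinates

variable {K : ℕ}

theorem coeff_toPoly_succ (v : Fin K → ZMod N) (i : Fin K) :
    (toPoly v).coeff (i + 1) = v i := by
  simp [toPoly, coeff_X_pow, Fin.val_inj]

theorem toPoly_injective : Function.Injective (toPoly (N := N) (K := K)) := by
  intro v w h
  ext i
  rw [← coeff_toPoly_succ v, h, coeff_toPoly_succ]

variable (N K) in
theorem range_toPoly :
    Set.range (toPoly (N := N) (K := K)) = {g | g.coeff 0 = 0 ∧ g.natDegree ≤ K} := by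
  ext g
  constructor
  · rintro ⟨v, rfl⟩
    refine ⟨by simp [toPoly], natDegree_sum_le_of_forall_le _ _ fun i _ => ?_⟩
    exact (natDegree_C_mul_X_pow_le _ _).trans i.isLt
  · rintro ⟨hcoeff, hdeg⟩
    refine ⟨fun i => g.coeff (i + 1), ?_⟩
    conv_rhs => rw [g.as_sum_range_C_mul_X_pow' (Nat.lt_succ_of_le hdeg), sum_range_succ']
    rw [hcoeff, C_0, zero_mul, add_zero, sum_range, toPoly]

variable (a b : ZMod N)

theorem toPoly_eq_newtonPoly (v : Fin K → ZMod N) :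
    toPoly v = newtonPoly (node a b) (matU a b K *ᵥ v) := by
  have hX (j : Fin K) : (X : (ZMod N)[X]) ^ ((j : ℕ) + 1) =
      ∑ i : Fin K, C (matU a b K i j) * newtonBasis (node a b) (i + 1) := by
    rw [X_pow_eq_sum_newtonBasis (node a b) (Nat.succ_lt_succ j.isLt), sum_range_succ',
      newtonCoeff, node_zero, zero_mul, C_0, zero_mul, add_zero, sum_range]
    simp only [matU_apply, Nat.succ_eq_add_one]
  simp only [toPoly, newtonPoly, hX, mulVec, dotProduct, map_sum, mul_sum, sum_mul]
  rw [sum_comm]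
  refine sum_congr rfl fun i _ => sum_congr rfl fun j _ => ?_
  rw [C_mul]
  ring

theorem toPoly_eq_comp :
    toPoly (N := N) (K := K) = newtonPoly (node a b) ∘ (matU a b K *ᵥ ·) :=
  funext (toPoly_eq_newtonPoly a b)

theorem newtonPoly_node_injective : Function.Injective (newtonPoly (node a b) (K := K)) :=
  (toPoly_eq_comp a b ▸ toPoly_injective).of_comp_right (mulVec_matU_bijective a b K).2

variable (K) in
theorem range_newtonPoly_node :
    Set.range (newtonPoly (node a b) (K := K)) = {g | g.coeff 0 = 0 ∧ g.natDegree ≤ K} := by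
  rw [← range_toPoly, toPoly_eq_comp a b, (mulVec_matU_bijective a b K).2.range_comp]

end Coordinates

section ZeroPolynomials

theorem explicitZero_eq_newtonPoly (K : ℕ) (τ : ℕ → ℕ) :
    explicitZero N K τ = newtonPoly (node 1 0) fun k : Fin K =>
      ((N / Nat.gcd (Nat.factorial (k + 1)) N * τ (k + 1) : ℕ) : ZMod N) := by
  rw [explicitZero, sum_Icc_eq_sum_fin, newtonPoly]
  simp only [newtonBasis, node, mul_one, mul_zero, add_zero]

variable [NeZero N]

theorem natCast_mul_eq_zero_iff (m : ℕ) (x : ZMod N) :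
    (m : ZMod N) * x = 0 ↔ ∃ τ < Nat.gcd m N, x = ((N / Nat.gcd m N * τ : ℕ) : ZMod N) := by
  have hgcd : Nat.gcd m N * (N / Nat.gcd m N) = N := Nat.mul_div_cancel' (Nat.gcd_dvd_right m N)
  have hdvd (n : ℕ) : (m : ZMod N) * n = 0 ↔ N / Nat.gcd m N ∣ n := by
    rw [mul_comm, ← nsmul_eq_mul, ← addOrderOf_dvd_iff_nsmul_eq_zero,
      ZMod.addOrderOf_coe m (NeZero.ne N), Nat.gcd_comm]
  constructor
  · intro h
    rw [← ZMod.natCast_zmod_val x, hdvd] at h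
    obtain ⟨τ, hτ⟩ := h
    refine ⟨τ, lt_of_mul_lt_mul_left' (a := N / Nat.gcd m N) ?_, ?_⟩
    · rw [← hτ, mul_comm _ (Nat.gcd m N), hgcd]
      exact x.val_lt
    · rw [← hτ, ZMod.natCast_zmod_val]
  · rintro ⟨τ, -, rfl⟩
    exact (hdvd _).2 (dvd_mul_right _ _)

variable (N) in
theorem ncard_natCast_mul_eq_zero (m : ℕ) :
    {x : ZMod N | (m : ZMod N) * x = 0}.ncard = Nat.gcd m N := by
  rw [Nat.gcd_comm]
  have h := IsAddCyclic.card_nsmulAddMonoidHom_ker (G := ZMod N) m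
  rw [Nat.card_zmod] at h
  rw [← h, ← Nat.card_coe_set_eq]
  simp only [← nsmul_eq_mul]
  rfl

-- The nodes for `a = 1`, `b = 0` are `0, 1, 2, …`, so the Newton basis consists of the products
-- `x (x - 1) ⋯ (x - k + 1)`.
theorem newtonPoly_mem_zeroPolys_iff {K : ℕ} (c : Fin K → ZMod N) :
    newtonPoly (node 1 0) c ∈ zeroPolys N K ↔ matD K *ᵥ c = 0 := by
  have hslopes : HasUnitSlopes (1 : ZMod N) 0 := fun m _ => by simp
  have hmem := Set.mem_range_self (f := newtonPoly (node (1 : ZMod N) 0)) c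
  rw [range_newtonPoly_node] at hmem
  constructor
  · rintro ⟨-, -, hzero⟩
    refine mulVec_injective_of_isUnit (hslopes.isUnit_matL K) ?_
    ext i
    rw [matL_mulVec_matD_mulVec, hzero, mulVec_zero, Pi.zero_apply]
  · intro hc
    refine ⟨hmem.1, hmem.2, fun x => ?_⟩
    have hx : node (1 : ZMod N) 0 x.val = x := by simp [node]
    rw [← hx, eval_newtonPoly]
    refine sum_eq_zero fun k _ => ?_
    rw [eval_newtonBasis_node, ← mul_assoc, mul_comm (c k), (matD_mulVec_eq_zero_iff c).1 hc,
      zero_mul]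

variable (N) in
theorem zeroPolys_eq_image (K : ℕ) :
    zeroPolys N K = newtonPoly (node 1 0) '' {c : Fin K → ZMod N | matD K *ᵥ c = 0} := by
  ext z
  constructor
  · intro hz
    obtain ⟨c, rfl⟩ := (range_newtonPoly_node K (1 : ZMod N) 0).ge ⟨hz.1, hz.2.1⟩
    exact ⟨c, (newtonPoly_mem_zeroPolys_iff c).1 hz, rfl⟩
  · rintro ⟨c, hc, rfl⟩
    exact (newtonPoly_mem_zeroPolys_iff c).2 hc

variable (N) in
theorem ncard_zeroPolys (K : ℕ) :
    (zeroPolys N K).ncard = ∏ k ∈ Icc 1 K, Nat.gcd (Nat.factorial k) N := by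
  have hpi : {c : Fin K → ZMod N | matD K *ᵥ c = 0} = Set.univ.pi fun k : Fin K =>
      {x : ZMod N | (((k : ℕ) + 1).factorial : ZMod N) * x = 0} := by
    ext c
    simp only [Set.mem_ofPred_eq, matD_mulVec_eq_zero_iff, Set.mem_univ_pi]
  rw [zeroPolys_eq_image, Set.ncard_image_of_injective _ (newtonPoly_node_injective 1 0), hpi,
    ← Nat.card_coe_set_eq, Nat.card_congr (Equiv.Set.univPi _), Nat.card_pi,
    prod_Icc_eq_prod_fin]
  simp only [Nat.card_coe_set_eq, ncard_natCast_mul_eq_zero]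

variable (N) in
theorem zeroPolys_eq_explicitZero (K : ℕ) :
    zeroPolys N K = {z | ∃ τ : ℕ → ℕ,
      (∀ k ∈ Icc 1 K, τ k ≤ Nat.gcd (Nat.factorial k) N - 1) ∧ z = explicitZero N K τ} := by
  have hgcd (m : ℕ) : 0 < Nat.gcd m N := Nat.gcd_pos_of_pos_right m (NeZero.pos N)
  rw [zeroPolys_eq_image]
  ext z
  simp only [Set.mem_image, Set.mem_ofPred_eq, matD_mulVec_eq_zero_iff, natCast_mul_eq_zero_iff]
  constructor
  · rintro ⟨c, hc, rfl⟩
    choose t ht hct using hc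
    have hinj : Function.Injective fun k : Fin K => (k : ℕ) + 1 :=
      (add_left_injective 1).comp Fin.val_injective
    refine ⟨Function.extend (fun k : Fin K => (k : ℕ) + 1) t 0, fun k hk => ?_, ?_⟩
    · obtain ⟨hk, hkK⟩ := mem_Icc.1 hk
      obtain ⟨k, rfl⟩ := Nat.exists_eq_add_of_le' hk
      rw [hinj.extend_apply t 0 ⟨k, hkK⟩]
      exact Nat.le_sub_one_of_lt (ht ⟨k, hkK⟩)
    · rw [explicitZero_eq_newtonPoly]
      congr 1
      ext k
      rw [hinj.extend_apply, hct]
  · rintro ⟨τ, hτ, rfl⟩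
    refine ⟨_, fun k => ⟨τ (k + 1), ?_, rfl⟩, (explicitZero_eq_newtonPoly K τ).symm⟩
    exact Nat.lt_of_le_sub_one (hgcd _) (hτ _ (mem_Icc.2 ⟨k.val.succ_pos, k.isLt⟩))

end ZeroPolynomials

section QuadraticPermutations

theorem surjective_eval_map {R S : Type*} [CommSemiring R] [CommSemiring S] {φ : R →+* S}
    (hφ : Function.Surjective φ) {f : R[X]} (hf : Function.Surjective fun x => f.eval x) :
    Function.Surjective fun x => (f.map φ).eval x := by
  intro z
  obtain ⟨y, rfl⟩ := hφ z
  obtain ⟨x, rfl⟩ := hf y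
  exact ⟨φ x, eval_map_apply ..⟩

theorem eq_zero_and_ne_zero_of_injective_quadratic {F : Type*} [Field F] (h2 : (2 : F) ≠ 0)
    {a b : F} (hinj : Function.Injective fun x : F => a * x + b * x ^ 2) : b = 0 ∧ a ≠ 0 := by
  have hb : b = 0 := by
    by_contra hb
    -- The reflection `x ↦ -a / b - x` preserves the values of the quadratic.
    have hreflect (x : F) : -a / b - x = x := hinj (by field_simp; ring)
    refine h2 ?_
    linear_combination hreflect 0 - hreflect 1
  refine ⟨hb, fun ha => zero_ne_one (α := F) (hinj ?_)⟩
  simp [ha, hb]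

variable {f₁ f₂ : ℤ}

theorem eval_quad (x : ZMod N) : (quad N f₁ f₂).eval x = f₁ * x + f₂ * x ^ 2 := by
  simp [quad]

theorem map_castHom_quad {M : ℕ} (h : M ∣ N) :
    (quad N f₁ f₂).map (ZMod.castHom h (ZMod M)) = quad M f₁ f₂ := by
  simp [quad]

theorem IsPP.quad_of_dvd [NeZero N] {M : ℕ} (h : M ∣ N) (hf : IsPP (quad N f₁ f₂)) :
    IsPP (quad M f₁ f₂) := by
  have : NeZero M := ⟨ne_zero_of_dvd_ne_zero (NeZero.ne N) h⟩
  refine ⟨by simp [quad], Finite.surjective_iff_bijective.1 ?_⟩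
  rw [← map_castHom_quad h]
  exact surjective_eval_map (ZMod.castHom_surjective h) hf.2.2

theorem IsPP.odd_left_of_quad_four (hf : IsPP (quad 4 f₁ f₂)) : Odd f₁ := by
  rw [← Int.not_even_iff_odd]
  rintro ⟨c, hc⟩
  refine absurd (hf.2.1 (a₁ := 0) (a₂ := 2) ?_) (by decide)
  have h4 : (4 : ZMod 4) = 0 := rfl
  simp only [eval_quad, hc, Int.cast_add]
  linear_combination -(c + f₂ : ZMod 4) * h4

theorem IsPP.not_dvd_add (hN : 1 < N) (hf : IsPP (quad N f₁ f₂)) : ¬ (N : ℤ) ∣ f₁ + f₂ := by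
  have : Fact (1 < N) := ⟨hN⟩
  intro h
  have hadd := (ZMod.intCast_zmod_eq_zero_iff_dvd (f₁ + f₂) N).2 h
  push_cast at hadd
  exact zero_ne_one (hf.2.1 (a₁ := 0) (a₂ := 1) (by simp [eval_quad, hadd]))

theorem IsPP.prime_dvd [NeZero N] (hf : IsPP (quad N f₁ f₂)) (hodd : 2 ∣ N → ¬ 4 ∣ N → Odd f₁)
    {p : ℕ} (hp : p.Prime) (hpN : p ∣ N) : (p : ℤ) ∣ f₂ ∧ ¬ (p : ℤ) ∣ f₁ := by
  have hfp := hf.quad_of_dvd hpN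
  obtain rfl | hp2 := hp.eq_two_or_odd'
  · have hf₁ : Odd f₁ := by
      by_cases h4 : 4 ∣ N
      · exact (hf.quad_of_dvd h4).odd_left_of_quad_four
      · exact hodd hpN h4
    have hsum := hfp.not_dvd_add one_lt_two
    rw [Nat.cast_ofNat, ← even_iff_two_dvd] at hsum ⊢
    rw [← even_iff_two_dvd]
    grind
  · have : Fact p.Prime := ⟨hp⟩
    have h2 : (2 : ZMod p) ≠ 0 := Ring.two_ne_zero (by
      rw [ZMod.ringChar_zmod_n]
      rintro rfl
      exact absurd hp2 (by decide))
    rw [← ZMod.intCast_zmod_eq_zero_iff_dvd, ← ZMod.intCast_zmod_eq_zero_iff_dvd]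
    refine eq_zero_and_ne_zero_of_injective_quadratic h2 ?_
    simpa only [eval_quad] using hfp.2.1

theorem IsPP.hasUnitSlopes [NeZero N] (hf : IsPP (quad N f₁ f₂))
    (hodd : 2 ∣ N → ¬ 4 ∣ N → Odd f₁) : HasUnitSlopes (f₁ : ZMod N) (f₂ : ZMod N) := by
  intro m _
  have hcast : (f₁ : ZMod N) + (m : ZMod N) * f₂ = ((f₁ + m * f₂ : ℤ) : ZMod N) := by
    push_cast
    rfl
  rw [hcast, ZMod.coe_int_isUnit_iff_isCoprime, Int.isCoprime_iff_gcd_eq_one, Int.gcd_def,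
    Int.natAbs_natCast]
  refine Nat.coprime_of_dvd fun p hp hpN hpm => ?_
  obtain ⟨hpf₂, hpf₁⟩ := hf.prime_dvd hodd hp hpN
  rw [← Int.natCast_dvd] at hpm
  exact hpf₁ ((dvd_add_left (hpf₂.mul_left _)).1 hpm)

end QuadraticPermutations

section Inverses

variable {f g : (ZMod N)[X]} {K : ℕ}

theorem IsInversePP.add_mem_zeroPolys {z : (ZMod N)[X]} (hg : IsInversePP f g)
    (hz : z ∈ zeroPolys N K) : IsInversePP f (g + z) := by
  obtain ⟨hcoeff, -, heval⟩ := hz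
  simpa [IsInversePP, IsPP, hcoeff, heval] using hg

theorem IsInversePP.sub_mem_zeroPolys {p : (ZMod N)[X]}
    (hf : Function.Surjective fun x : ZMod N => f.eval x) (hg : IsInversePP f g)
    (hp : IsInversePP f p) (hgK : g.natDegree ≤ K) (hpK : p.natDegree ≤ K) :
    p - g ∈ zeroPolys N K := by
  refine ⟨by rw [coeff_sub, hp.1.1, hg.1.1, sub_zero],
    (natDegree_sub_le _ _).trans (max_le hpK hgK), fun y => ?_⟩
  obtain ⟨x, rfl⟩ := hf y
  rw [eval_sub, hp.2, hg.2, sub_self]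

theorem IsLeastInverseDegree.mem_inversesOfDegree_iff (hK : IsLeastInverseDegree f K) :
    g ∈ inversesOfDegree f K ↔ IsInversePP f g ∧ g.natDegree ≤ K :=
  and_congr_right fun hg => ⟨le_of_eq, fun h => h.antisymm (hK.2 ⟨g, hg, rfl⟩)⟩

theorem IsLeastInverseDegree.inversesOfDegree_eq_add_zeroPolys (hK : IsLeastInverseDegree f K)
    (hf : Function.Surjective fun x : ZMod N => f.eval x) (hg : g ∈ inversesOfDegree f K) :
    inversesOfDegree f K = {p | ∃ z ∈ zeroPolys N K, p = g + z} := by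
  ext p
  rw [hK.mem_inversesOfDegree_iff] at hg ⊢
  constructor
  · rintro ⟨hp, hpK⟩
    exact ⟨p - g, hg.1.sub_mem_zeroPolys hf hp hg.2 hpK, (add_sub_cancel g p).symm⟩
  · rintro ⟨z, hz, rfl⟩
    exact ⟨hg.1.add_mem_zeroPolys hz, (natDegree_add_le _ _).trans (max_le hg.2 hz.2.1)⟩

theorem IsLeastInverseDegree.ncard_inversesOfDegree (hK : IsLeastInverseDegree f K)
    (hf : Function.Surjective fun x : ZMod N => f.eval x) :
    (inversesOfDegree f K).ncard = (zeroPolys N K).ncard := by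
  obtain ⟨g, hg⟩ := hK.1
  rw [hK.inversesOfDegree_eq_add_zeroPolys hf hg,
    ← Set.ncard_image_of_injective (zeroPolys N K) (add_right_injective g)]
  simp only [Set.image, eq_comm]

theorem isInversePP_iff [NeZero N] :
    IsInversePP f g ↔ g.coeff 0 = 0 ∧ ∀ x : ZMod N, g.eval (f.eval x) = x := by
  refine ⟨fun h => ⟨h.1.1, h.2⟩, fun h => ⟨⟨h.1, Finite.surjective_iff_bijective.1 ?_⟩, h.2⟩⟩
  exact Function.RightInverse.surjective h.2

end Inverses

theorem isLeast_upperClosure_iff {α : Type*} [PartialOrder α] {s : Set α} {a : α} :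
    IsLeast (upperClosure s : Set α) a ↔ IsLeast s a := by
  rw [IsLeast, IsLeast, lowerBounds_upperClosure]
  refine and_congr_left fun ha => ⟨?_, fun h => subset_upperClosure h⟩
  rintro ⟨b, hb, hba⟩
  rwa [hba.antisymm (ha hb)] at hb

section QuadraticInverses

variable [NeZero N] {f₁ f₂ : ℤ}

theorem isInversePP_quad_iff {n : ℕ} (hn : N ≤ n + 1) {g : (ZMod N)[X]} :
    IsInversePP (quad N f₁ f₂) g ↔ g.coeff 0 = 0 ∧ ∀ i : Fin n,
      g.eval (node (f₁ : ZMod N) (f₂ : ZMod N) (i + 1)) = vecB (ZMod N) n i := by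
  have hnode (i : ℕ) : (quad N f₁ f₂).eval (i : ZMod N) = node (f₁ : ZMod N) (f₂ : ZMod N) i := by
    rw [eval_quad, node, mul_comm, mul_comm (f₂ : ZMod N)]
  rw [isInversePP_iff]
  refine and_congr_right fun hcoeff => ⟨fun h i => ?_, fun h x => ?_⟩
  · rw [← hnode, h, vecB, Nat.cast_succ]
  · rw [← ZMod.natCast_zmod_val x, hnode]
    have hx : x.val < n + 1 := x.val_lt.trans_le hn
    generalize x.val = i at hx
    cases i with
    | zero => rw [node_zero, ← coeff_zero_eq_eval_zero, hcoeff, Nat.cast_zero]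
    | succ i => rw [h ⟨i, Nat.lt_of_succ_lt_succ hx⟩, vecB, Nat.cast_succ]

theorem forall_factorial_mul_inverseDifference_eq_zero_iff
    (hu : HasUnitSlopes (f₁ : ZMod N) (f₂ : ZMod N)) (K : ℕ) :
    (∀ i : Fin N, ((K + i + 1).factorial : ZMod N) *
      inverseDifference (f₁ : ZMod N) (f₂ : ZMod N) 0 (K + i + 1) = 0) ↔
      ((K + 1).factorial : ZMod N) * catalan K * (f₂ : ZMod N) ^ K = 0 := by
  simp only [hu.factorial_mul_inverseDifference_eq_zero_iff]
  refine ⟨fun h => ?_, fun h i => factorial_mul_catalan_mul_pow_eq_zero_of_le le_self_add h⟩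
  simpa using h 0

theorem isInversePP_newtonPoly_iff (hu : HasUnitSlopes (f₁ : ZMod N) (f₂ : ZMod N)) {K : ℕ}
    (h : Fin K → ZMod N) :
    IsInversePP (quad N f₁ f₂) (newtonPoly (node (f₁ : ZMod N) (f₂ : ZMod N)) h) ↔
      matD K *ᵥ h = matD K *ᵥ inverseCoords (f₁ : ZMod N) (f₂ : ZMod N) K ∧
      ((K + 1).factorial : ZMod N) * catalan K * (f₂ : ZMod N) ^ K = 0 := by
  have hcoeff : (newtonPoly (node (f₁ : ZMod N) f₂) h).coeff 0 = 0 :=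
    ((range_newtonPoly_node K (f₁ : ZMod N) f₂).le ⟨h, rfl⟩).1
  -- Zeros are appended so that the interpolation conditions run over all residues.
  have hL := mulVec_injective_of_isUnit (hu.isUnit_matL (K + N))
  rw [isInversePP_quad_iff (n := K + N) (by omega), and_iff_right hcoeff,
    ← newtonPoly_append_zero (n := N)]
  simp only [← matL_mulVec_matD_mulVec]
  rw [← funext_iff, ← hu.matL_mulVec_matD_mulVec_inverseCoords, hL.eq_iff, funext_iff,
    Fin.forall_fin_add, ← forall_factorial_mul_inverseDifference_eq_zero_iff hu, funext_iff]
  simp only [matD, mulVec_diagonal, inverseCoords, Fin.append_left, Fin.append_right,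
    Fin.val_castAdd, Fin.val_natAdd, Pi.zero_apply, mul_zero, eq_comm (a := (0 : ZMod N))]

theorem exists_isInversePP_natDegree_le_iff (hu : HasUnitSlopes (f₁ : ZMod N) (f₂ : ZMod N))
    (K : ℕ) :
    (∃ g, IsInversePP (quad N f₁ f₂) g ∧ g.natDegree ≤ K) ↔
      ((K + 1).factorial : ZMod N) * catalan K * (f₂ : ZMod N) ^ K = 0 := by
  constructor
  · rintro ⟨g, hg, hgK⟩
    obtain ⟨h, rfl⟩ := (range_newtonPoly_node K (f₁ : ZMod N) f₂).ge ⟨hg.1.1, hgK⟩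
    exact ((isInversePP_newtonPoly_iff hu h).1 hg).2
  · intro hK
    exact ⟨_, (isInversePP_newtonPoly_iff hu _).2 ⟨rfl, hK⟩,
      ((range_newtonPoly_node K (f₁ : ZMod N) f₂).le ⟨_, rfl⟩).2⟩

theorem isLeastInverseDegree_quad_iff (hN : 1 < N)
    (hu : HasUnitSlopes (f₁ : ZMod N) (f₂ : ZMod N)) (K : ℕ) :
    IsLeastInverseDegree (quad N f₁ f₂) K ↔ IsLeast {K : ℕ | 1 ≤ K ∧
      (Nat.factorial (K + 1) : ℤ) * (catalan K : ℤ) * f₂ ^ K ≡ 0 [ZMOD (N : ℤ)]} K := by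
  have : Fact (1 < N) := ⟨hN⟩
  rw [IsLeastInverseDegree, ← isLeast_upperClosure_iff]
  congr!
  ext d
  have hd : d ∈ upperClosure {d | ∃ g, IsInversePP (quad N f₁ f₂) g ∧ g.natDegree = d} ↔
      ((d + 1).factorial : ZMod N) * catalan d * (f₂ : ZMod N) ^ d = 0 := by
    simp [← exists_isInversePP_natDegree_le_iff hu, mem_upperClosure]
  rw [SetLike.mem_coe, hd, Set.mem_ofPred_eq, ← ZMod.intCast_eq_intCast_iff]
  push_cast
  refine ⟨fun h => ⟨Nat.one_le_iff_ne_zero.2 ?_, h⟩, And.right⟩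
  rintro rfl
  simp at h

theorem exists_isInversePP_quad_natDegree_le (hu : HasUnitSlopes (f₁ : ZMod N) (f₂ : ZMod N)) :
    ∃ g, IsInversePP (quad N f₁ f₂) g ∧ g.natDegree ≤ N - 1 := by
  rw [exists_isInversePP_natDegree_le_iff hu, Nat.sub_add_cancel (NeZero.one_le (n := N)),
    (ZMod.natCast_eq_zero_iff _ _).2 (Nat.dvd_factorial (NeZero.pos N) le_rfl), zero_mul, zero_mul]

theorem exists_isLeastInverseDegree_quad (hu : HasUnitSlopes (f₁ : ZMod N) (f₂ : ZMod N)) :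
    ∃ K, IsLeastInverseDegree (quad N f₁ f₂) K := by
  obtain ⟨g, hg, -⟩ := exists_isInversePP_quad_natDegree_le hu
  exact ⟨_, isLeast_csInf ⟨_, g, hg, rfl⟩⟩

namespace IsLeastInverseDegree

variable {K : ℕ}

theorem le_sub_one (hK : IsLeastInverseDegree (quad N f₁ f₂) K)
    (hu : HasUnitSlopes (f₁ : ZMod N) (f₂ : ZMod N)) : K ≤ N - 1 := by
  obtain ⟨g, hg, hgN⟩ := exists_isInversePP_quad_natDegree_le hu
  exact (hK.2 ⟨g, hg, rfl⟩).trans hgN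

theorem toPoly_mem_inversesOfDegree_iff (hK : IsLeastInverseDegree (quad N f₁ f₂) K)
    (hu : HasUnitSlopes (f₁ : ZMod N) (f₂ : ZMod N)) (v : Fin K → ZMod N) :
    toPoly v ∈ inversesOfDegree (quad N f₁ f₂) K ↔
      matD K *ᵥ (matU (f₁ : ZMod N) (f₂ : ZMod N) K *ᵥ v) =
        matD K *ᵥ inverseCoords (f₁ : ZMod N) (f₂ : ZMod N) K := by
  obtain ⟨g, hg, hgK⟩ := hK.1
  have hdeg : (toPoly v).natDegree ≤ K := ((range_toPoly N K).le ⟨v, rfl⟩).2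
  rw [hK.mem_inversesOfDegree_iff, and_iff_left hdeg, toPoly_eq_newtonPoly (f₁ : ZMod N) f₂,
    isInversePP_newtonPoly_iff hu, and_iff_left]
  exact (exists_isInversePP_natDegree_le_iff hu K).1 ⟨g, hg, hgK.le⟩

theorem inversesOfDegree_eq_toPoly_of_matD_matU (hK : IsLeastInverseDegree (quad N f₁ f₂) K)
    (hu : HasUnitSlopes (f₁ : ZMod N) (f₂ : ZMod N)) :
    inversesOfDegree (quad N f₁ f₂) K = {g | ∃ h v : Fin K → ZMod N,
      matD K *ᵥ h = matD K *ᵥ inverseCoords (f₁ : ZMod N) (f₂ : ZMod N) K ∧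
      h = matU (f₁ : ZMod N) (f₂ : ZMod N) K *ᵥ v ∧ g = toPoly v} := by
  ext g
  constructor
  · intro hg
    obtain ⟨v, rfl⟩ := (range_toPoly N K).ge ⟨hg.1.1.1, hg.2.le⟩
    exact ⟨_, v, (hK.toPoly_mem_inversesOfDegree_iff hu v).1 hg, rfl, rfl⟩
  · rintro ⟨_, v, hv, rfl, rfl⟩
    exact (hK.toPoly_mem_inversesOfDegree_iff hu v).2 hv

end IsLeastInverseDegree

end QuadraticInverses

end QPP

theorem mainTheorem1_general (N : ℕ) (hN : 2 ≤ N) (f₁ f₂ : ℤ)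
    (hf : QPP.IsPP (QPP.quad N f₁ f₂))
    (hodd : 2 ∣ N → ¬ 4 ∣ N → Odd f₁) :
    (∀ m : ℕ, 1 ≤ m → IsUnit ((f₁ : ZMod N) + (m : ZMod N) * (f₂ : ZMod N))) ∧
    IsUnit (QPP.matL (f₁ : ZMod N) (f₂ : ZMod N) (N - 1)) ∧
    (∃ K : ℕ, QPP.IsLeastInverseDegree (QPP.quad N f₁ f₂) K) ∧
    (∀ K : ℕ, QPP.IsLeastInverseDegree (QPP.quad N f₁ f₂) K ↔
      IsLeast {K : ℕ | 1 ≤ K ∧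
        (Nat.factorial (K + 1) : ℤ) * (catalan K : ℤ) * f₂ ^ K ≡ 0 [ZMOD (N : ℤ)]} K) ∧
    ∀ K : ℕ, QPP.IsLeastInverseDegree (QPP.quad N f₁ f₂) K →
      (QPP.inversesOfDegree (QPP.quad N f₁ f₂) K).ncard =
        ∏ k ∈ Finset.Icc 1 K, Nat.gcd (Nat.factorial k) N ∧
      (QPP.zeroPolys N K).ncard = ∏ k ∈ Finset.Icc 1 K, Nat.gcd (Nat.factorial k) N ∧
      QPP.zeroPolys N K =
        {z | ∃ τ : ℕ → ℕ,
          (∀ k ∈ Finset.Icc 1 K, τ k ≤ Nat.gcd (Nat.factorial k) N - 1) ∧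
          z = QPP.explicitZero N K τ} ∧
      ∃ hK : K ≤ N - 1,
        (QPP.inversesOfDegree (QPP.quad N f₁ f₂) K =
          {g | ∃ h v : Fin K → ZMod N,
            Matrix.mulVec (QPP.leadMat hK (QPP.matD (N - 1))) h =
              QPP.leadVec hK (QPP.vecE (f₁ : ZMod N) (f₂ : ZMod N) (N - 1)) ∧
            h = Matrix.mulVec
              (QPP.leadMat hK (QPP.matU (f₁ : ZMod N) (f₂ : ZMod N) (N - 1))) v ∧
            g = QPP.toPoly v}) ∧
        (∃! v : Fin K → ZMod N,
          QPP.particularH N f₁ f₂ K = Matrix.mulVec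
            (QPP.leadMat hK (QPP.matU (f₁ : ZMod N) (f₂ : ZMod N) (N - 1))) v) ∧
        (∀ v : Fin K → ZMod N,
          QPP.particularH N f₁ f₂ K = Matrix.mulVec
            (QPP.leadMat hK (QPP.matU (f₁ : ZMod N) (f₂ : ZMod N) (N - 1))) v →
          QPP.inversesOfDegree (QPP.quad N f₁ f₂) K =
            {g | ∃ z ∈ QPP.zeroPolys N K, g = QPP.toPoly v + z}) := by
  have : NeZero N := ⟨by omega⟩
  have hu := hf.hasUnitSlopes hodd
  refine ⟨hu, hu.isUnit_matL _, QPP.exists_isLeastInverseDegree_quad hu,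
    QPP.isLeastInverseDegree_quad_iff hN hu, fun K hK => ?_⟩
  refine ⟨(hK.ncard_inversesOfDegree hf.2.2).trans (QPP.ncard_zeroPolys N K),
    QPP.ncard_zeroPolys N K, QPP.zeroPolys_eq_explicitZero N K, hK.le_sub_one hu, ?_⟩
  rw [QPP.leadMat_matU, QPP.leadMat_matD, hu.leadVec_vecE, hu.particularH_eq]
  refine ⟨hK.inversesOfDegree_eq_toPoly_of_matD_matU hu, ?_, fun v hv => ?_⟩
  · simpa only [eq_comm] using (QPP.mulVec_matU_bijective _ _ K).existsUnique _
  · refine hK.inversesOfDegree_eq_add_zeroPolys hf.2.2 ?_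
    rw [hK.toPoly_mem_inversesOfDegree_iff hu, hv]

theorem mainTheorem1 (N : ℕ) (hN : 2 ≤ N) (hN' : N ≤ 2 ^ 50) (f₁ f₂ : ℤ)
    (hf : QPP.IsPP (QPP.quad N f₁ f₂))
    (hodd : 2 ∣ N → ¬ 4 ∣ N → Odd f₁) :
    -- the divisions below are meaningful
    (∀ m : ℕ, 1 ≤ m → IsUnit ((f₁ : ZMod N) + (m : ZMod N) * (f₂ : ZMod N))) ∧
    IsUnit (QPP.matL (f₁ : ZMod N) (f₂ : ZMod N) (N - 1)) ∧
    -- the least degree of an inverse exists, and is characterized by the congruence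
    (∃ K : ℕ, QPP.IsLeastInverseDegree (QPP.quad N f₁ f₂) K) ∧
    (∀ K : ℕ, QPP.IsLeastInverseDegree (QPP.quad N f₁ f₂) K ↔
      IsLeast {K : ℕ | 1 ≤ K ∧
        (Nat.factorial (K + 1) : ℤ) * (catalan K : ℤ) * f₂ ^ K ≡ 0 [ZMOD (N : ℤ)]} K) ∧
    ∀ K : ℕ, QPP.IsLeastInverseDegree (QPP.quad N f₁ f₂) K →
      -- the number of inverses of least degree
      (QPP.inversesOfDegree (QPP.quad N f₁ f₂) K).ncard =
        ∏ k ∈ Finset.Icc 1 K, Nat.gcd (Nat.factorial k) N ∧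
      -- the zero polynomials: their number and form
      (QPP.zeroPolys N K).ncard = ∏ k ∈ Finset.Icc 1 K, Nat.gcd (Nat.factorial k) N ∧
      QPP.zeroPolys N K =
        {z | ∃ τ : ℕ → ℕ,
          (∀ k ∈ Finset.Icc 1 K, τ k ≤ Nat.gcd (Nat.factorial k) N - 1) ∧
          z = QPP.explicitZero N K τ} ∧
      ∃ hK : K ≤ N - 1,
        -- (1) all inverses of least degree from the linear congruences
        (QPP.inversesOfDegree (QPP.quad N f₁ f₂) K =
          {g | ∃ h v : Fin K → ZMod N,
            Matrix.mulVec (QPP.leadMat hK (QPP.matD (N - 1))) h =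
              QPP.leadVec hK (QPP.vecE (f₁ : ZMod N) (f₂ : ZMod N) (N - 1)) ∧
            h = Matrix.mulVec
              (QPP.leadMat hK (QPP.matU (f₁ : ZMod N) (f₂ : ZMod N) (N - 1))) v ∧
            g = QPP.toPoly v}) ∧
        -- (2) all inverses of least degree from one explicit solution and the zero polynomials
        (∃! v : Fin K → ZMod N,
          QPP.particularH N f₁ f₂ K = Matrix.mulVec
            (QPP.leadMat hK (QPP.matU (f₁ : ZMod N) (f₂ : ZMod N) (N - 1))) v) ∧
        (∀ v : Fin K → ZMod N,
          QPP.particularH N f₁ f₂ K = Matrix.mulVec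
            (QPP.leadMat hK (QPP.matU (f₁ : ZMod N) (f₂ : ZMod N) (N - 1))) v →
          QPP.inversesOfDegree (QPP.quad N f₁ f₂) K =
            {g | ∃ z ∈ QPP.zeroPolys N K, g = QPP.toPoly v + z}) :=
  mainTheorem1_general N hN f₁ f₂ hf hodd
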